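/- Consider $M\ge 1$ identical processors and a finite system of sporadic DAG tasks $\tau_i$ with implicit deadlines. Task $\tau_i$ has a minimum inter-arrival time $T_i>0$, which is also its relative deadline, and a non-empty set of finite directed acyclic graphs whose nodes (subtasks) have non-negative execution times. Each job of $\tau_i$ executes one of these DAGs (different jobs may execute different ones); the sum of all execution times of the DAG of a job is at most $C_i$, and the length of its critical path (a directed path with the largest sum of execution times) is at most $\Psi_i$. The jobs are released at times $\ge 0$, distinct jobs of $\tau_i$ at least $T_i$ apart. A subtask of a job is ready when the job has been released, all earlier jobs of the same task are completed, all predecessors of the subtask have been executed, and the subtask itself is unfinished. Global rate-monotonic scheduling (global RM) is preemptive: at every time at most $M$ subtasks are executed, all of them ready, and a ready subtask waits only if $M$ subtasks are being executed, all of them of tasks whose periods are at most the period of the task of the waiting subtask (ties are broken arbitrarily). The system is schedulable by global RM on $M$ processors if, for all legal releases of jobs and all schedules that global RM can produce, each job is completed at the latest $T_i$ time units after its release. Corollary. There is exactly one real number $b>0$ with $\frac1b=\ln\frac{3}{2+\frac1b}$; it satisfies $b\approx 3.62143$ (precisely $|b-3.62143|<5\cdot10^{-6}$), and hence $b<3.73$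 (where $3.73$ is the previously known value). The number $b$ is a capacity augmentation factor of global RM for sporadic DAG task systems with implicit deadlines: for every $M\ge1$, every such system with $\sum_i \frac{C_i}{T_i}\le \frac{M}{b}$ and $\frac{\Psi_i}{T_i}\le\frac1b$ for all $i$ is schedulable by global RM on $M$ processors. -/

import Mathlib

open MeasureTheory

namespace DAGSched

/-- A finite directed acyclic graph of subtasks. `edge u v` says that `v` depends on `u`, and
`time v` is the execution time of the subtask `v`. -/
structure ExecDAG where
  size : ℕ
  edge : Fin size → Fin size → Prop
  acyclic : ∀ v, ¬ Relation.TransGen edge v v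
  time : Fin size → ℝ
  time_nonneg : ∀ v, 0 ≤ time v

namespace ExecDAG

/-- Total execution time of all subtasks. -/
noncomputable def work (G : ExecDAG) : ℝ := ∑ v, G.time v

/-- A (possibly empty) directed path, given by the list of its nodes. -/
def IsPath (G : ExecDAG) (l : List (Fin G.size)) : Prop := l.IsChain G.edge

/-- The sum of the execution times of the nodes on a list. -/
noncomputable def pathLength (G : ExecDAG) (l : List (Fin G.size)) : ℝ := (l.map G.time).sum

/-- Length of a longest directed path. The set of lengths is nonempty (empty path) and bounded,
see `bddAbove_pathLength`, so the supremum is the true one. -/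
noncomputable def criticalPath (G : ExecDAG) : ℝ :=
  sSup {x | ∃ l, G.IsPath l ∧ x = G.pathLength l}

theorem IsPath.nodup {G : ExecDAG} {l : List (Fin G.size)} (h : G.IsPath l) : l.Nodup := by
  have h1 : l.IsChain (Relation.TransGen G.edge) :=
    List.IsChain.imp (fun _ _ hab => Relation.TransGen.single hab) h
  have h2 : l.Pairwise (Relation.TransGen G.edge) := List.isChain_iff_pairwise.mp h1
  have h3 : ∀ a b, Relation.TransGen G.edge a b → a ≠ b := by
    rintro a b hab rfl
    exact G.acyclic a hab
  exact h2.imp (fun {a b} hab => h3 a b hab)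

theorem IsPath.pathLength_le_work {G : ExecDAG} {l : List (Fin G.size)} (h : G.IsPath l) :
    G.pathLength l ≤ G.work := by
  unfold pathLength work
  rw [← List.sum_toFinset _ h.nodup]
  exact Finset.sum_le_sum_of_subset_of_nonneg (Finset.subset_univ _)
    (fun v _ _ => G.time_nonneg v)

theorem bddAbove_pathLength (G : ExecDAG) :
    BddAbove {x | ∃ l, G.IsPath l ∧ x = G.pathLength l} :=
  ⟨G.work, by rintro x ⟨l, hl, rfl⟩; exact hl.pathLength_le_work⟩

theorem IsPath.pathLength_le_criticalPath {G : ExecDAG} {l : List (Fin G.size)}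
    (h : G.IsPath l) : G.pathLength l ≤ G.criticalPath :=
  le_csSup G.bddAbove_pathLength ⟨l, h, rfl⟩

end ExecDAG

/-- A sporadic DAG task with implicit deadline. `patterns` is the set of DAGs that a job of the
task may have to execute (different jobs may have different DAGs), `period` is the minimum
inter-arrival time and also the relative deadline, `C` is the total-work parameter and `Ψ` the
critical-path-length parameter of the task. -/
structure DAGTask where
  period : ℝ
  period_pos : 0 < period
  C : ℝ
  Ψ : ℝ
  patterns : Set ExecDAG
  patterns_nonempty : patterns.Nonempty
  work_le : ∀ G ∈ patterns, G.work ≤ C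
  criticalPath_le : ∀ G ∈ patterns, G.criticalPath ≤ Ψ

/-- The utilization of a task. -/
noncomputable def DAGTask.utilization (τ : DAGTask) : ℝ := τ.C / τ.period

/-- A legal release pattern of the task system `τ`; the jobs are indexed by `J`. Each job belongs
to a task, is released at a time `≥ 0` and has one of the DAGs of its task; distinct jobs of one
task are released at least one period apart. A task may release any number of jobs (none,
finitely many, infinitely many). -/
structure JobSequence {ι : Type} (τ : ι → DAGTask) (J : Type) where
  task : J → ι
  release : J → ℝ
  release_nonneg : ∀ j, 0 ≤ release j
  dag : J → ExecDAG
  dag_mem : ∀ j, dag j ∈ (τ (task j)).patterns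
  separated : ∀ j j', j ≠ j' → task j = task j' → (τ (task j)).period ≤ |release j - release j'|

namespace JobSequence

variable {ι : Type} {τ : ι → DAGTask} {J : Type}

/-- The absolute deadline of a job. -/
def deadline (S : JobSequence τ J) (j : J) : ℝ := S.release j + (τ (S.task j)).period

/-- A preemptive schedule tells at which times each subtask of each job is being executed. -/
abbrev Schedule (S : JobSequence τ J) : Type := (j : J) → Fin (S.dag j).size → Set ℝ

/-- Amount of execution that the subtask `v` of job `j` has received up to time `t`. -/
noncomputable def executed (S : JobSequence τ J) (run : S.Schedule) (j : J)
    (v : Fin (S.dag j).size) (t : ℝ) : ℝ :=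
  volume.real (run j v ∩ Set.Icc 0 t)

/-- By time `t` the job `j` has been completely executed. -/
def Completed (S : JobSequence τ J) (run : S.Schedule) (j : J) (t : ℝ) : Prop :=
  ∀ v, (S.dag j).time v ≤ S.executed run j v t

/-- The subtask `v` of job `j` is ready (has been released, still needs execution, and may be
executed) at time `t`: all earlier jobs of the same task are completed, all (direct and indirect)
predecessors of `v` have been executed, and `v` itself is unfinished. -/
def Ready (S : JobSequence τ J) (run : S.Schedule) (j : J) (v : Fin (S.dag j).size)
    (t : ℝ) : Prop :=
  S.release j ≤ t ∧
  (∀ j', S.task j' = S.task j → S.release j' < S.release j → S.Completed run j' t) ∧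
  (∀ u, Relation.TransGen (S.dag j).edge u v → (S.dag j).time u ≤ S.executed run j u t) ∧
  S.executed run j v t < (S.dag j).time v

/-- The set of all subtasks of all jobs that are being executed at time `t`. -/
def running (S : JobSequence τ J) (run : S.Schedule) (t : ℝ) :
    Set ((j : J) × Fin (S.dag j).size) :=
  {p | t ∈ run p.1 p.2}

/-- The schedule is produced by preemptive global rate-monotonic scheduling on `M` identical
processors: at every time only ready subtasks are executed, on at most `M` processors; and a ready
subtask is left waiting only if all `M` processors are busy with subtasks of tasks of at least the
same priority, i.e. of at most the same period. Ties are broken arbitrarily. -/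
structure IsGlobalRM (S : JobSequence τ J) (M : ℕ) (run : S.Schedule) : Prop where
  measurable : ∀ j v, MeasurableSet (run j v)
  ready_of_running : ∀ j v t, t ∈ run j v → S.Ready run j v t
  card_running_le : ∀ t, (S.running run t).encard ≤ M
  busy_of_waiting : ∀ j v t, S.Ready run j v t → t ∉ run j v →
    (S.running run t).encard = M ∧
    ∀ p ∈ S.running run t, (τ (S.task p.1)).period ≤ (τ (S.task j)).period

end JobSequence

/-- The task system `τ` is schedulable by global RM on `M` processors: for all legal release
patterns, all jobs meet their deadlines in all schedules that global RM can produce. -/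
def GlobalRMSchedulable {ι : Type} (M : ℕ) (τ : ι → DAGTask) : Prop :=
  ∀ (J : Type) (S : JobSequence τ J) (run : S.Schedule), S.IsGlobalRM M run →
    ∀ j, S.Completed run j (S.deadline j)

/-- `b` is a capacity augmentation factor of global RM for sporadic implicit-deadline DAG task
systems: for every number `M ≥ 1` of processors, every finite task system of total utilization at
most `M / b` in which every critical-path length is at most the period divided by `b` is
schedulable by global RM on `M` processors. -/
def IsCapacityAugmentationFactorGlobalRM (b : ℝ) : Prop :=
  ∀ (M : ℕ), 1 ≤ M → ∀ (ι : Type) [Fintype ι] (τ : ι → DAGTask),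
    ∑ i, (τ i).utilization ≤ M / b →
    (∀ i, (τ i).Ψ / (τ i).period ≤ 1 / b) →
    GlobalRMSchedulable M τ

end DAGSched

namespace DAGSched

/-! The equation for `b` matters only through `1 / b ≤ 0.277`; for every such `b` an elementary
counting argument proves schedulability.

Take a job `k` with the earliest missed deadline `d`; let `D` be its period, `β = 1 / b`, and `F`
the jobs of period at most `D` released before `d`. Call a time idle if fewer than `M` subtasks of
`F` run. While a job of `F` is unfinished, idle time shortens a path of its DAG, so at most `β`
times its period is idle (`idle_le_of_not_completed`). At other times `M` processors do work of `F`,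
which from time `a` on is at most the total work of the jobs unfinished at `a` (`mul_sub_idle_le`).
As earlier deadlines are met, a task of period `T` has `n` such jobs with `n * T < d - a + 2 * T`
(`card_unfinished_mul_lt`).

Apply this with `a` the release of `k`. If `n * T ≤ 2.6 * D` for all tasks, then `1 - β ≤ 2.6 * β`,
which is false. Otherwise some task has exactly three unfinished jobs and `T > 2.6 / 3 * D`.
Restarting from the release of the first of them gives a window longer than `5.2 / 3 * D` with idle
time at most `2 * β * D`, again too much work. -/

theorem ExecDAG.IsPath.exists_extend {G : ExecDAG} {u v : Fin G.size}
    (h : Relation.TransGen G.edge u v) {l : List (Fin G.size)} (hl : G.IsPath (l ++ [u])) :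
    ∃ l', G.IsPath (l' ++ [v]) ∧ G.pathLength (l ++ [u]) ≤ G.pathLength l' := by
  induction h with
  | single h =>
    refine ⟨l ++ [u], ?_, le_rfl⟩
    refine List.IsChain.append hl (List.isChain_singleton _) ?_
    intro x hx y hy
    simp_all
  | @tail w z _ hwz ih =>
    obtain ⟨l', hl', hle⟩ := ih
    refine ⟨l' ++ [w], ?_, hle.trans ?_⟩
    · refine List.IsChain.append hl' (List.isChain_singleton _) ?_
      intro x hx y hy
      simp_all
    · simp [pathLength, G.time_nonneg w]

/-! ### Execution received by a subtask -/

namespace JobSequence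

variable {ι : Type} {τ : ι → DAGTask} {J : Type} {S : JobSequence τ J} {run : S.Schedule}

theorem executed_mono (j : J) (v : Fin (S.dag j).size) : Monotone (S.executed run j v) := by
  intro s t hst
  refine measureReal_mono (Set.inter_subset_inter_right _ (Set.Icc_subset_Icc_right hst)) ?_
  exact ((measure_mono Set.inter_subset_right).trans_lt measure_Icc_lt_top).ne

theorem Completed.mono {j : J} {s t : ℝ} (h : S.Completed run j s) (hst : s ≤ t) :
    S.Completed run j t := fun v => (h v).trans (executed_mono j v hst)

theorem executed_add {j : J} {v : Fin (S.dag j).size} {s t : ℝ} (hs : 0 ≤ s) (hst : s ≤ t) :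
    S.executed run j v t = S.executed run j v s + volume.real (run j v ∩ Set.Ioc s t) := by
  have hfin : ∀ a b : ℝ, volume (run j v ∩ Set.Icc a b) ≠ ⊤ := fun a b =>
    ((measure_mono Set.inter_subset_right).trans_lt measure_Icc_lt_top).ne
  have h := measureReal_inter_add_sdiff (μ := volume) (s := run j v ∩ Set.Icc 0 t)
    (measurableSet_Icc (a := (0 : ℝ)) (b := s)) (hfin 0 t)
  unfold executed
  rw [← h]
  congr 2
  · ext x
    simp only [Set.mem_inter_iff, Set.mem_Icc]
    constructor
    · tauto
    · rintro ⟨h1, h2, h3⟩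
      exact ⟨⟨h1, h2, h3.trans hst⟩, h2, h3⟩
  · ext x
    simp only [Set.mem_inter_iff, Set.mem_Icc, Set.mem_sdiff, Set.mem_Ioc]
    constructor
    · rintro ⟨⟨h1, h2, h3⟩, h4⟩
      exact ⟨h1, by by_contra h5; exact h4 ⟨h2, not_lt.mp h5⟩, h3⟩
    · rintro ⟨h1, h2, h3⟩
      exact ⟨⟨h1, hs.trans h2.le, h3⟩, fun h4 => absurd h4.2 (not_le.mpr h2)⟩

theorem executed_lipschitz (j : J) (v : Fin (S.dag j).size) {s t : ℝ} (hs : 0 ≤ s)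
    (hst : s ≤ t) : S.executed run j v t ≤ S.executed run j v s + (t - s) := by
  rw [executed_add hs hst]
  gcongr
  calc volume.real (run j v ∩ Set.Ioc s t) ≤ volume.real (Set.Ioc s t) :=
        measureReal_mono Set.inter_subset_right (by simp)
    _ = t - s := by simp [hst]

theorem continuousOn_executed (j : J) (v : Fin (S.dag j).size) :
    ContinuousOn (S.executed run j v) (Set.Ici 0) := by
  refine LipschitzOnWith.continuousOn (K := 1) (LipschitzOnWith.of_le_add_mul 1 ?_)
  intro x hx y hy
  rcases le_total x y with h | h
  · have := executed_mono (run := run) j v h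
    have := dist_nonneg (x := x) (y := y)
    simp only [NNReal.coe_one, one_mul]
    linarith
  · have := executed_lipschitz (run := run) j v hy h
    rw [Real.dist_eq, abs_of_nonneg (sub_nonneg.mpr h)]
    simpa using this

namespace IsGlobalRM

variable {M : ℕ}

/-- By continuity an excess would be preceded by a time of exact completion, after which the subtask
is never ready and so never runs. -/
theorem executed_le_time (h : S.IsGlobalRM M run) (j : J) (v : Fin (S.dag j).size) (t : ℝ) :
    S.executed run j v t ≤ (S.dag j).time v := by
  rcases le_or_gt t 0 with ht | ht
  · refine le_trans (le_of_eq ?_) ((S.dag j).time_nonneg v)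
    have h0 : volume (run j v ∩ Set.Icc 0 t) = 0 := by
      refine measure_mono_null Set.inter_subset_right ?_
      simp [ht]
    simp [executed, measureReal_def, h0]
  · by_contra! hlt
    have h0 : S.executed run j v 0 ≤ (S.dag j).time v := by
      refine le_trans (le_of_eq ?_) ((S.dag j).time_nonneg v)
      have h0 : volume (run j v ∩ Set.Icc 0 0) = 0 :=
        measure_mono_null Set.inter_subset_right (by simp)
      simp only [executed, measureReal_def, h0, ENNReal.toReal_zero]
    obtain ⟨s, hs, hsv⟩ := intermediate_value_Icc ht.le
      ((continuousOn_executed (run := run) j v).mono Set.Icc_subset_Ici_self) ⟨h0, hlt.le⟩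
    have hempty : run j v ∩ Set.Ioc s t = ∅ := by
      ext x
      simp only [Set.mem_inter_iff, Set.mem_Ioc, Set.mem_empty_iff_false, iff_false, not_and]
      intro hx hsx
      have h1 := (h.ready_of_running j v x hx).2.2.2
      have h2 := executed_mono (run := run) j v (le_of_lt hsx)
      linarith
    have h3 := executed_add (run := run) (v := v) hs.1 hs.2
    rw [hempty, measureReal_empty] at h3
    linarith

end IsGlobalRM

/-! ### Idle time and critical paths -/

/-- The jobs of tasks of period at most `P` that are released before time `d`. -/
def IsJobsBefore (S : JobSequence τ J) (P d : ℝ) (F : Finset J) : Prop :=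
  ∀ j, j ∈ F ↔ S.release j < d ∧ (τ (S.task j)).period ≤ P

/-- Separation makes the task together with the index of the period-long slot containing the release
determine the job. -/
theorem finite_release_lt [Finite ι] (S : JobSequence τ J) (d : ℝ) :
    {j | S.release j < d}.Finite := by
  classical
  have hfin : (⋃ i : ι, Set.image (fun n : ℕ => (i, n))
      (Set.Iic ⌊d / (τ i).period⌋₊)).Finite :=
    Set.finite_iUnion fun i => (Set.finite_Iic _).image _
  refine Set.Finite.of_injOn
    (f := fun j => (S.task j, ⌊S.release j / (τ (S.task j)).period⌋₊)) ?_ ?_ hfin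
  · intro j hj
    simp only [Set.mem_iUnion, Set.mem_image]
    exact ⟨S.task j, _, Nat.floor_le_floor
      (div_le_div_of_nonneg_right (le_of_lt hj) (τ (S.task j)).period_pos.le), rfl⟩
  · intro j _ j' _ hjj
    simp only [Prod.mk.injEq] at hjj
    obtain ⟨ht, hf⟩ := hjj
    by_contra hne
    have hsep := S.separated j j' hne ht
    rw [← ht] at hf
    have hT := (τ (S.task j)).period_pos
    set T := (τ (S.task j)).period
    have a1 := Nat.floor_le (div_nonneg (S.release_nonneg j) hT.le)
    have a2 := Nat.lt_floor_add_one (S.release j / T)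
    have b1 := Nat.floor_le (div_nonneg (S.release_nonneg j') hT.le)
    have b2 := Nat.lt_floor_add_one (S.release j' / T)
    rw [← hf] at b1 b2
    have hlt : |S.release j / T - S.release j' / T| < 1 := by
      rw [abs_lt]; constructor <;> linarith
    rw [← sub_div, abs_div, abs_of_pos hT, div_lt_one hT] at hlt
    linarith

/-- Number of subtasks of the jobs in `F` that are executed at time `t`. -/
noncomputable def load (run : S.Schedule) (F : Finset J) (t : ℝ) : ℝ :=
  ∑ p ∈ F.sigma fun j => (Finset.univ : Finset (Fin (S.dag j).size)), (run p.1 p.2).indicator 1 t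

theorem IsGlobalRM.measurable_load {M : ℕ} (h : S.IsGlobalRM M run) (F : Finset J) :
    Measurable (load run F) :=
  Finset.measurable_fun_sum _ fun p _ => measurable_const.indicator (h.measurable p.1 p.2)

/-- The times at which fewer than `M` subtasks of jobs in `F` are executed. -/
def idle (M : ℕ) (run : S.Schedule) (F : Finset J) : Set ℝ := {t | load run F t < M}

theorem IsGlobalRM.measurableSet_idle {M : ℕ} (h : S.IsGlobalRM M run) (F : Finset J) :
    MeasurableSet (idle M run F) :=
  measurableSet_lt (h.measurable_load F) measurable_const

/-- If the subtask waited, all `M` running subtasks would have period at most `P` and belong to jobs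
of `F`, so the load would be `M`. -/
theorem IsGlobalRM.mem_run_of_mem_idle {M : ℕ} (h : S.IsGlobalRM M run) {F : Finset J} {P d : ℝ}
    (hF : S.IsJobsBefore P d F) {j : J} {v : Fin (S.dag j).size} {t : ℝ}
    (hj : (τ (S.task j)).period ≤ P) (ht : t < d) (hr : S.Ready run j v t)
    (hi : t ∈ idle M run F) : t ∈ run j v := by
  classical
  by_contra hn
  obtain ⟨hcard, hper⟩ := h.busy_of_waiting j v t hr hn
  have hset : S.running run t =
      (((F.sigma fun j => (Finset.univ : Finset (Fin (S.dag j).size))).filter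
        fun p => t ∈ run p.1 p.2 : Finset ((j : J) × Fin (S.dag j).size)) : Set ((j : J) × Fin (S.dag j).size)) := by
    ext p
    simp only [running, Set.mem_ofPred_eq, Finset.coe_filter, Finset.mem_sigma, Finset.mem_univ,
      and_true]
    refine ⟨fun hp => ⟨(hF _).2 ⟨?_, (hper p hp).trans hj⟩, hp⟩, fun hp => hp.2⟩
    exact (h.ready_of_running _ _ _ hp).1.trans_lt ht
  rw [hset, Set.encard_coe_eq_coe_finsetCard] at hcard
  have hload : load run F t = M := by
    rw [load, ← Nat.cast_inj.mp hcard]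
    simp [Set.indicator_apply, Finset.sum_boole]
  simp only [idle, Set.mem_ofPred_eq, hload, lt_irrefl] at hi

/-- A subtask that is unfinished all the time forces the idle time to be covered by a path. -/
theorem IsGlobalRM.exists_path_of_unfinished {M : ℕ} (h : S.IsGlobalRM M run) {F : Finset J}
    {P d : ℝ} (hF : S.IsJobsBefore P d F) {j : J} {t : ℝ}
    (hj : (τ (S.task j)).period ≤ P) (ht : t ≤ d)
    (hprev : ∀ j', S.task j' = S.task j → S.release j' < S.release j →
      S.Completed run j' (S.release j)) (v : Fin (S.dag j).size) :
    ∃ l, (S.dag j).IsPath (l ++ [v]) ∧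
      volume.real (idle M run F ∩ Set.Ico (S.release j) t ∩
        {s | S.executed run j v s < (S.dag j).time v}) ≤ (S.dag j).pathLength (l ++ [v]) := by
  classical
  have hwf : WellFounded (Relation.TransGen (S.dag j).edge) := by
    have : Std.Irrefl (Relation.TransGen (S.dag j).edge) := ⟨(S.dag j).acyclic⟩
    exact Finite.wellFounded_of_trans_of_irrefl _
  set I := idle M run F ∩ Set.Ico (S.release j) t with hI
  set U : Fin (S.dag j).size → Set ℝ := fun v => {s | S.executed run j v s < (S.dag j).time v}
    with hU
  have hUlow : ∀ v, IsLowerSet (U v) := fun v a b hba ha =>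
    (executed_mono j v hba).trans_lt ha
  have hfin : ∀ X : Set ℝ, volume (I ∩ X) ≠ ⊤ := fun X =>
    ((measure_mono (Set.inter_subset_left.trans Set.inter_subset_right)).trans_lt
      measure_Ico_lt_top).ne
  have hIm : MeasurableSet I := (h.measurableSet_idle F).inter measurableSet_Ico
  induction v using hwf.induction with
  | _ v ih =>
  have hrun : ∀ s ∈ I ∩ U v, (∀ u, Relation.TransGen (S.dag j).edge u v → s ∉ U u) →
      s ∈ run j v ∩ Set.Icc 0 t := by
    intro s hs hanc
    refine ⟨h.mem_run_of_mem_idle hF hj (hs.1.2.2.trans_le ht) ⟨hs.1.2.1, ?_, ?_, hs.2⟩ hs.1.1,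
      (S.release_nonneg j).trans hs.1.2.1, hs.1.2.2.le⟩
    · exact fun j' h1 h2 => (hprev j' h1 h2).mono hs.1.2.1
    · exact fun u hu => not_lt.mp (hanc u hu)
  have hexec : volume.real (run j v ∩ Set.Icc 0 t) ≤ (S.dag j).time v :=
    h.executed_le_time j v t
  have hfin' : volume (run j v ∩ Set.Icc 0 t) ≠ ⊤ :=
    ((measure_mono Set.inter_subset_right).trans_lt measure_Icc_lt_top).ne
  by_cases hne : ∃ u, Relation.TransGen (S.dag j).edge u v
  · obtain ⟨u, hu, hmax⟩ : ∃ u, Relation.TransGen (S.dag j).edge u v ∧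
        ∀ w, Relation.TransGen (S.dag j).edge w v → U w ⊆ U u := by
      obtain ⟨u, hu⟩ := Set.Finite.exists_maximalFor U
        {u | Relation.TransGen (S.dag j).edge u v} (Set.toFinite _) hne
      refine ⟨u, hu.1, fun w hw => ?_⟩
      rcases (hUlow w).total (hUlow u) with h1 | h1
      · exact h1
      · exact hu.2 hw h1
    obtain ⟨l, hl, hle⟩ := ih u hu
    -- `u` need not be a direct predecessor; inserting intermediate nodes only lengthens the path.
    obtain ⟨l', hl', hle'⟩ := hl.exists_extend hu
    refine ⟨l', hl', ?_⟩
    -- Once `u` is finished, all ancestors are, so `v` is ready and runs whenever the time is idle.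
    have hsub : I ∩ U v ⊆ (I ∩ U u) ∪ (run j v ∩ Set.Icc 0 t) := by
      intro s hs
      by_cases hsu : s ∈ U u
      · exact Or.inl ⟨hs.1, hsu⟩
      · exact Or.inr (hrun s hs fun w hw hsw => hsu (hmax w hw hsw))
    calc volume.real (I ∩ U v)
        ≤ volume.real ((I ∩ U u) ∪ (run j v ∩ Set.Icc 0 t)) :=
          measureReal_mono hsub (measure_union_lt_top (hfin _).lt_top hfin'.lt_top).ne
      _ ≤ volume.real (I ∩ U u) + volume.real (run j v ∩ Set.Icc 0 t) :=
          measureReal_union_le _ _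
      _ ≤ (S.dag j).pathLength l' + (S.dag j).time v := by linarith
      _ = (S.dag j).pathLength (l' ++ [v]) := by simp [ExecDAG.pathLength]
  · refine ⟨[], List.isChain_singleton _, ?_⟩
    push Not at hne
    calc volume.real (I ∩ U v) ≤ volume.real (run j v ∩ Set.Icc 0 t) :=
          measureReal_mono (fun s hs => hrun s hs fun u hu => absurd hu (hne u)) hfin'
      _ ≤ (S.dag j).pathLength ([] ++ [v]) := by simpa [ExecDAG.pathLength] using hexec

theorem IsGlobalRM.idle_le_of_not_completed {M : ℕ} (h : S.IsGlobalRM M run) {F : Finset J}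
    {P d : ℝ} (hF : S.IsJobsBefore P d F) {j : J} {t : ℝ}
    (hj : (τ (S.task j)).period ≤ P) (ht : t ≤ d)
    (hprev : ∀ j', S.task j' = S.task j → S.release j' < S.release j →
      S.Completed run j' (S.release j)) (hnc : ¬ S.Completed run j t) :
    volume.real (idle M run F ∩ Set.Ico (S.release j) t) ≤ (τ (S.task j)).Ψ := by
  simp only [Completed, not_forall, not_le] at hnc
  obtain ⟨v, hv⟩ := hnc
  obtain ⟨l, hl, hle⟩ := h.exists_path_of_unfinished hF hj ht hprev v
  rw [Set.inter_eq_self_of_subset_left] at hle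
  · exact hle.trans (hl.pathLength_le_criticalPath.trans ((τ _).criticalPath_le _ (S.dag_mem j)))
  · intro s hs
    exact (executed_mono j v hs.2.2.le).trans_lt hv

end JobSequence

end DAGSched

/-! ### Work and number of unfinished jobs -/

namespace DAGSched

theorem DAGTask.C_nonneg (τ : DAGTask) : 0 ≤ τ.C := by
  obtain ⟨G, hG⟩ := τ.patterns_nonempty
  exact (Finset.sum_nonneg fun v _ => G.time_nonneg v).trans (τ.work_le G hG)

theorem DAGTask.utilization_nonneg (τ : DAGTask) : 0 ≤ τ.utilization :=
  div_nonneg τ.C_nonneg τ.period_pos.le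

/-- Among `n + 1` reals that are pairwise at least `T` apart, two differ by at least `n T`. -/
theorem exists_add_mul_le_of_separated {J : Type} (x : J → ℝ) (T : ℝ) (n : ℕ) (s : Finset J)
    (hs : s.card = n + 1)
    (hsep : ∀ j ∈ s, ∀ j' ∈ s, j ≠ j' → T ≤ |x j - x j'|) :
    ∃ j ∈ s, ∃ j' ∈ s, x j + n * T ≤ x j' := by
  classical
  induction n generalizing s with
  | zero =>
    obtain ⟨j, hj⟩ := Finset.card_pos.mp (by omega : 0 < s.card)
    exact ⟨j, hj, j, hj, by simp⟩
  | succ n ih =>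
    obtain ⟨m, hm, hmax⟩ := s.exists_max_image x (Finset.card_pos.mp (by omega))
    obtain ⟨j, hj, j', hj', hle⟩ := ih (s.erase m) (by rw [Finset.card_erase_of_mem hm]; omega)
      fun a ha b hb => hsep a (Finset.mem_of_mem_erase ha) b (Finset.mem_of_mem_erase hb)
    refine ⟨j, Finset.mem_of_mem_erase hj, m, hm, ?_⟩
    have h1 := hsep m hm j' (Finset.mem_of_mem_erase hj') (Finset.ne_of_mem_erase hj').symm
    rw [abs_of_nonneg (sub_nonneg.mpr (hmax j' (Finset.mem_of_mem_erase hj')))] at h1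
    push_cast
    linarith

namespace JobSequence

variable {ι : Type} {τ : ι → DAGTask} {J : Type} {S : JobSequence τ J} {run : S.Schedule}

/-- The processors are busy outside of the idle time, with jobs unfinished at time `a`. -/
theorem IsGlobalRM.mul_sub_idle_le {M : ℕ} (h : S.IsGlobalRM M run) (F : Finset J) {a d : ℝ}
    (ha : 0 ≤ a) (had : a ≤ d) [DecidablePred fun j => ¬ S.Completed run j a] :
    M * (d - a - volume.real (idle M run F ∩ Set.Ico a d)) ≤
      ∑ j ∈ F with ¬ S.Completed run j a, (τ (S.task j)).C := by
  set μ := (volume : Measure ℝ).restrict (Set.Ioo a d) with hμ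
  have hint : ∀ p : (j : J) × Fin (S.dag j).size,
      Integrable ((run p.1 p.2).indicator (1 : ℝ → ℝ)) μ := fun p =>
    (integrable_const (1 : ℝ)).indicator (h.measurable p.1 p.2)
  have hload : Integrable (load run F) μ := integrable_finsetSum _ fun p _ => hint p
  have hnonneg : ∀ t, 0 ≤ load run F t := fun t =>
    Finset.sum_nonneg fun p _ => Set.indicator_nonneg (fun _ _ => zero_le_one) _
  -- Markov's inequality: the busy time is weighed against the work done.
  have hmarkov : M * μ.real {t | (M : ℝ) ≤ load run F t} ≤ ∫ t, load run F t ∂μ :=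
    mul_meas_ge_le_integral_of_nonneg (Filter.Eventually.of_forall hnonneg) hload M
  have hbusy : d - a - volume.real (idle M run F ∩ Set.Ico a d) ≤
      μ.real {t | (M : ℝ) ≤ load run F t} := by
    have h1 := measureReal_add_measureReal_compl (μ := μ) (h.measurableSet_idle F)
    have h2 : (idle M run F)ᶜ = {t | (M : ℝ) ≤ load run F t} := by
      ext t; simp [idle]
    have h3 : μ.real Set.univ = d - a := by simp [hμ, had]
    have h4 : μ.real (idle M run F) ≤ volume.real (idle M run F ∩ Set.Ico a d) := by
      rw [hμ, measureReal_restrict_apply (h.measurableSet_idle F)]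
      exact measureReal_mono (Set.inter_subset_inter_right _ Set.Ioo_subset_Ico_self)
        ((measure_mono Set.inter_subset_right).trans_lt measure_Ico_lt_top).ne
    rw [h2, h3] at h1
    linarith
  have hIoc : ∀ (j : J) (v : Fin (S.dag j).size),
      μ.real (run j v) ≤ volume.real (run j v ∩ Set.Ioc a d) := by
    intro j v
    rw [hμ, measureReal_restrict_apply (h.measurable j v)]
    exact measureReal_mono (Set.inter_subset_inter_right _ Set.Ioo_subset_Ioc_self)
      ((measure_mono Set.inter_subset_right).trans_lt measure_Ioc_lt_top).ne
  have hjob : ∀ j, ∑ v, μ.real (run j v) ≤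
      if ¬ S.Completed run j a then (τ (S.task j)).C else 0 := by
    intro j
    split_ifs with hc
    · refine Finset.sum_nonpos fun v _ => ?_
      have h1 := h.executed_le_time j v d
      rw [executed_add ha had] at h1
      linarith [hIoc j v, hc v]
    · refine le_trans (Finset.sum_le_sum fun v _ => ?_) ((τ _).work_le _ (S.dag_mem j))
      have h1 := h.executed_le_time j v d
      rw [executed_add ha had] at h1
      have h2 : 0 ≤ S.executed run j v a := measureReal_nonneg
      linarith [hIoc j v]
  have hintegral : ∫ t, load run F t ∂μ = ∑ j ∈ F, ∑ v, μ.real (run j v) := by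
    unfold load
    rw [integral_finsetSum _ fun p _ => hint p, Finset.sum_sigma]
    refine Finset.sum_congr rfl fun j _ => Finset.sum_congr rfl fun v _ => ?_
    exact integral_indicator_one (h.measurable j v)
  calc M * (d - a - volume.real (idle M run F ∩ Set.Ico a d))
      ≤ M * μ.real {t | (M : ℝ) ≤ load run F t} := by gcongr
    _ ≤ ∑ j ∈ F, ∑ v, μ.real (run j v) := hmarkov.trans_eq hintegral
    _ ≤ ∑ j ∈ F, if ¬ S.Completed run j a then (τ (S.task j)).C else 0 :=
        Finset.sum_le_sum fun j _ => hjob j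
    _ = _ := (Finset.sum_filter _ _).symm

/-- If every task has few jobs that are unfinished at time `a`, then the idle time is long. -/
theorem IsGlobalRM.mul_sub_idle_le_of_card [Fintype ι] [DecidableEq ι] {M : ℕ}
    (h : S.IsGlobalRM M run) (F : Finset J) {a d κ : ℝ} (ha : 0 ≤ a) (had : a ≤ d)
    [DecidablePred fun j => ¬ S.Completed run j a]
    (hκ : ∀ i, (F.filter fun j => ¬ S.Completed run j a ∧ S.task j = i).card * (τ i).period ≤ κ) :
    M * (d - a - volume.real (idle M run F ∩ Set.Ico a d)) ≤ (∑ i, (τ i).utilization) * κ := by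
  refine (h.mul_sub_idle_le F ha had).trans ?_
  rw [← Finset.sum_fiberwise _ S.task, Finset.sum_mul]
  refine Finset.sum_le_sum fun i _ => ?_
  rw [Finset.filter_filter]
  have h1 : ∑ j ∈ F with ¬ S.Completed run j a ∧ S.task j = i, (τ (S.task j)).C =
      (F.filter fun j => ¬ S.Completed run j a ∧ S.task j = i).card * (τ i).C := by
    rw [Finset.sum_congr rfl (g := fun _ => (τ i).C), Finset.sum_const, nsmul_eq_mul]
    intro j hj
    rw [(Finset.mem_filter.mp hj).2.2]
  rw [h1]
  have hT := (τ i).period_pos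
  calc _ = (τ i).utilization *
        ((F.filter fun j => ¬ S.Completed run j a ∧ S.task j = i).card * (τ i).period) := by
        unfold DAGTask.utilization; field_simp
    _ ≤ _ := mul_le_mul_of_nonneg_left (hκ i) (τ i).utilization_nonneg

/-- The first of `n` unfinished jobs is released after `a - T`, since its deadline cannot have
passed; the last is released before `d`; they are at least `(n - 1) * T` apart. -/
theorem card_unfinished_mul_lt [DecidableEq ι] {F : Finset J} {P d a : ℝ}
    (hF : S.IsJobsBefore P d F) (had : a < d)
    (hdl : ∀ j, S.deadline j < d → S.Completed run j (S.deadline j))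
    [DecidablePred fun j => ¬ S.Completed run j a] (i : ι) :
    (F.filter fun j => ¬ S.Completed run j a ∧ S.task j = i).card * (τ i).period
      < d - a + 2 * (τ i).period := by
  have hT := (τ i).period_pos
  set s := F.filter fun j => ¬ S.Completed run j a ∧ S.task j = i with hs
  have hmem : ∀ j ∈ s, S.release j < d ∧ ¬ S.Completed run j a ∧ S.task j = i := fun j hj =>
    ⟨((hF j).1 (Finset.mem_filter.mp hj).1).1, (Finset.mem_filter.mp hj).2⟩
  rcases Nat.eq_zero_or_pos s.card with h0 | h0
  · rw [h0, Nat.cast_zero, zero_mul]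
    linarith
  · obtain ⟨n, hn⟩ := Nat.exists_eq_add_of_lt h0
    rw [zero_add] at hn
    obtain ⟨j, hj, j', hj', hle⟩ := exists_add_mul_le_of_separated S.release (τ i).period n s hn
      fun j hj j' hj' hne => by
        have := S.separated j j' hne ((hmem j hj).2.2.trans (hmem j' hj').2.2.symm)
        rwa [(hmem j hj).2.2] at this
    have h1 : a < S.release j + (τ i).period := by
      by_contra! hlt
      rw [← (hmem j hj).2.2] at hlt
      exact (hmem j hj).2.1 ((hdl j (lt_of_le_of_lt hlt had)).mono hlt)
    rw [hn]
    push_cast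
    linarith [(hmem j' hj').1]

/-! ### The earliest missed deadline -/

/-- If all earlier deadlines are met, then a job meets its deadline. -/
theorem IsGlobalRM.completed_deadline_of_earlier [Fintype ι] {M : ℕ} (h : S.IsGlobalRM M run)
    (hM : 1 ≤ M) {β : ℝ} (hβ : 0 < β) (hβ' : β ≤ 0.277)
    (hU : ∑ i, (τ i).utilization ≤ M * β) (hΨ : ∀ i, (τ i).Ψ ≤ β * (τ i).period) (k : J)
    (hdl : ∀ j, S.deadline j < S.deadline k → S.Completed run j (S.deadline j)) :
    S.Completed run k (S.deadline k) := by
  classical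
  by_contra hk
  set d := S.deadline k with hd
  set D := (τ (S.task k)).period with hD
  have hDpos : 0 < D := (τ (S.task k)).period_pos
  have hdk : d = S.release k + D := rfl
  have hfin : {j | S.release j < d ∧ (τ (S.task j)).period ≤ D}.Finite :=
    (finite_release_lt S d).subset fun j hj => hj.1
  set F := hfin.toFinset with hFdef
  have hF : S.IsJobsBefore D d F := fun j => by simp [hFdef]
  have hprev : ∀ j, S.release j < d → ∀ j', S.task j' = S.task j → S.release j' < S.release j →
      S.Completed run j' (S.release j) := by
    intro j hj j' ht hlt
    have hne : j' ≠ j := by rintro rfl; exact lt_irrefl _ hlt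
    have h1 := S.separated j' j hne ht
    rw [abs_of_neg (sub_neg.mpr hlt)] at h1
    have h2 : S.deadline j' ≤ S.release j := by unfold deadline; linarith
    exact (hdl j' (h2.trans_lt hj)).mono h2
  have hidle : ∀ j ∈ F, ∀ t ≤ d, ¬ S.Completed run j t →
      volume.real (idle M run F ∩ Set.Ico (S.release j) t) ≤ β * (τ (S.task j)).period :=
    fun j hj t ht hnc => (h.idle_le_of_not_completed hF ((hF j).1 hj).2 ht
      (hprev j ((hF j).1 hj).1) hnc).trans (hΨ _)
  have hkF : k ∈ F := (hF k).2 ⟨by linarith, le_rfl⟩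
  have hNk := hidle k hkF d le_rfl hk
  rw [← hD] at hNk
  have hcard := fun i => card_unfinished_mul_lt hF
    (by linarith : S.release k < d) hdl i
  -- The constant 2.6 works because `1 - β ≤ 2.6 * β` would force `β ≥ 1 / 3.6 > 0.277`.
  obtain ⟨i, hi⟩ : ∃ i, 2.6 * D < (F.filter fun j => ¬ S.Completed run j (S.release k) ∧
      S.task j = i).card * (τ i).period := by
    by_contra! hall
    have h1 := h.mul_sub_idle_le_of_card F (d := d) (S.release_nonneg k) (by linarith) hall
    have h2 : (∑ i, (τ i).utilization) * (2.6 * D) ≤ M * β * (2.6 * D) :=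
      mul_le_mul_of_nonneg_right hU (by positivity)
    have h3 : M * (D * (1 - β)) ≤ M * (β * (2.6 * D)) := by
      refine le_trans (mul_le_mul_of_nonneg_left ?_ (by positivity)) (h1.trans (h2.trans_eq ?_))
      · linarith
      · ring
    have h4 := le_of_mul_le_mul_left h3 (by positivity)
    nlinarith
  set s := F.filter fun j => ¬ S.Completed run j (S.release k) ∧ S.task j = i with hs
  have hsF : ∀ j ∈ s, j ∈ F ∧ ¬ S.Completed run j (S.release k) ∧ S.task j = i :=
    fun j hj => Finset.mem_filter.mp hj
  have hTpos := (τ i).period_pos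
  have hTD : (τ i).period ≤ D := by
    have hne : s.card ≠ 0 := by
      intro h0
      rw [h0, Nat.cast_zero, zero_mul] at hi
      linarith
    obtain ⟨j, hj⟩ := Finset.card_pos.mp (Nat.pos_of_ne_zero hne)
    have := ((hF j).1 (hsF j hj).1).2
    rwa [(hsF j hj).2.2] at this
  have hlt := hcard i
  -- Two jobs give at most `2 * D`; four or more would give `T < D / 2`, hence a product below `2 *
  -- D`.
  have hsc : s.card = 3 := by
    have h1 : 2 < s.card := by
      have : (2 : ℝ) < s.card := by
        by_contra! hle
        nlinarith
      exact_mod_cast this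
    have h2 : s.card < 4 := by
      have : (s.card : ℝ) < 4 := by
        by_contra! hle
        nlinarith
      exact_mod_cast this
    omega
  rw [hsc] at hi
  push_cast at hi
  obtain ⟨j, hj, j', hj', hle⟩ := exists_add_mul_le_of_separated S.release (τ i).period 2 s hsc
    fun j hj j' hj' hne => by
      have := S.separated j j' hne ((hsF j hj).2.2.trans (hsF j' hj').2.2.symm)
      rwa [(hsF j hj).2.2] at this
  push_cast at hle
  have hj'd := ((hF j').1 (hsF j' hj').1).1
  have hNj := hidle j (hsF j hj).1 (S.release k) (by linarith) (hsF j hj).2.1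
  rw [(hsF j hj).2.2] at hNj
  set a := S.release j with ha
  -- Job `j` is unfinished up to the release of `k`, and `k` from there to `d`; each pays for its
  -- part.
  have hN : volume.real (idle M run F ∩ Set.Ico a d) ≤ 2 * (β * D) := by
    have hsub : idle M run F ∩ Set.Ico a d ⊆ (idle M run F ∩ Set.Ico a (S.release k)) ∪
        (idle M run F ∩ Set.Ico (S.release k) d) := by
      rw [← Set.inter_union_distrib_left]
      exact Set.inter_subset_inter_right _ Set.Ico_subset_Ico_union_Ico
    have hfin : ∀ x y : ℝ, volume (idle M run F ∩ Set.Ico x y) < ⊤ := fun x y =>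
      (measure_mono Set.inter_subset_right).trans_lt measure_Ico_lt_top
    have h1 := (measureReal_mono hsub (measure_union_lt_top (hfin _ _) (hfin _ _)).ne).trans
      (measureReal_union_le _ _)
    have h2 : β * (τ i).period ≤ β * D := mul_le_mul_of_nonneg_left hTD hβ.le
    linarith
  have had : a < d := by linarith
  -- A task without jobs in the filter may have period above `D`, hence the case split.
  have h1 := h.mul_sub_idle_le_of_card F (S.release_nonneg j) had.le (κ := d - a + 2 * D) (by
    intro i'
    rcases Nat.eq_zero_or_pos (F.filter fun j' => ¬ S.Completed run j' a ∧ S.task j' = i').card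
      with h0 | h0
    · rw [h0, Nat.cast_zero, zero_mul]
      linarith
    · obtain ⟨j₁, hj₁⟩ := Finset.card_pos.mp h0
      obtain ⟨h1, _, h3⟩ := Finset.mem_filter.mp hj₁
      have h4 := ((hF j₁).1 h1).2
      rw [h3] at h4
      linarith [card_unfinished_mul_lt hF had hdl i'])
  have h2 : (∑ i, (τ i).utilization) * (d - a + 2 * D) ≤ M * β * (d - a + 2 * D) :=
    mul_le_mul_of_nonneg_right hU (by linarith)
  have h3 : M * (d - a - 2 * (β * D)) ≤ M * (β * (d - a + 2 * D)) := by
    refine le_trans (mul_le_mul_of_nonneg_left ?_ (by positivity)) (h1.trans (h2.trans_eq ?_))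
    · linarith
    · ring
  have h4 := le_of_mul_le_mul_left h3 (by positivity)
  have h5 : 5.2 / 3 * D < d - a := by linarith
  -- Now `(d - a) * (1 - β) ≤ 4 * β * D` with `d - a > 5.2 / 3 * D` would need `β > 0.3`.
  nlinarith

end JobSequence

theorem isCapacityAugmentationFactorGlobalRM_of_le {b : ℝ} (hb : 0 < b) (hb' : 1 / b ≤ 0.277) :
    IsCapacityAugmentationFactorGlobalRM b := by
  intro M hM ι _ τ hU hΨ J S run h j
  have hΨ' : ∀ i, (τ i).Ψ ≤ 1 / b * (τ i).period := fun i =>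
    (div_le_iff₀ (τ i).period_pos).mp (hΨ i)
  have hU' : ∑ i, (τ i).utilization ≤ M * (1 / b) := by rwa [mul_one_div]
  by_contra hj
  have hfin : {j' | ¬ S.Completed run j' (S.deadline j') ∧
      S.deadline j' ≤ S.deadline j}.Finite := by
    refine (JobSequence.finite_release_lt S (S.deadline j)).subset fun j' hj' => ?_
    have h1 := hj'.2
    have h2 := (τ (S.task j')).period_pos
    have h3 : S.deadline j' = S.release j' + (τ (S.task j')).period := rfl
    show S.release j' < S.deadline j
    linarith
  obtain ⟨k, hk, hmin⟩ := Set.exists_min_image _ S.deadline hfin ⟨j, hj, le_rfl⟩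
  refine hk.1 (h.completed_deadline_of_earlier hM (one_div_pos.mpr hb) hb' hU' hΨ' k ?_)
  intro j' hlt
  by_contra hj'
  exact absurd (hmin j' ⟨hj', hlt.le.trans hk.2⟩) (not_le.mpr hlt)

end DAGSched

/-! ### The root of the logarithmic equation -/

theorem strictMonoOn_add_log_two_add :
    StrictMonoOn (fun x : ℝ => x + Real.log (2 + x)) (Set.Ici 0) := by
  intro x hx y _ hxy
  have hx' : (0 : ℝ) ≤ x := hx
  have := Real.log_lt_log (by linarith : 0 < 2 + x) (by linarith : 2 + x < 2 + y)
  simp only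
  linarith

theorem eq_log_iff {x : ℝ} (hx : 0 < x) :
    x = Real.log (3 / (2 + x)) ↔ x + Real.log (2 + x) = Real.log 3 := by
  rw [Real.log_div (by norm_num) (by linarith)]
  constructor <;> intro h <;> linarith

theorem add_log_two_add_lt_log_three :
    1 / 3.621435 + Real.log (2 + 1 / 3.621435) < Real.log 3 := by
  have h : Real.exp (1 / 3.621435) < 3 / (2 + 1 / 3.621435) := by
    refine (Real.exp_bound' (n := 8) (by norm_num) (by norm_num) (by norm_num)).trans_lt ?_
    norm_num [Finset.sum_range_succ, Nat.factorial]
  rw [← Real.lt_log_iff_exp_lt (by norm_num), Real.log_div (by norm_num) (by norm_num)] at h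
  linarith

theorem log_three_lt_add_log_two_add :
    Real.log 3 < 1 / 3.621425 + Real.log (2 + 1 / 3.621425) := by
  have h : 3 / (2 + 1 / 3.621425) < Real.exp (1 / 3.621425) := by
    refine lt_of_lt_of_le ?_ (Real.sum_le_exp_of_nonneg (by norm_num) 8)
    norm_num [Finset.sum_range_succ, Nat.factorial]
  rw [← Real.log_lt_iff_lt_exp (by norm_num), Real.log_div (by norm_num) (by norm_num)] at h
  linarith

theorem mainTheorem5 :
    ∃ b : ℝ,
      (0 < b ∧ 1 / b = Real.log (3 / (2 + 1 / b))) ∧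
      (∀ b' : ℝ, 0 < b' → 1 / b' = Real.log (3 / (2 + 1 / b')) → b' = b) ∧
      |b - 3.62143| < 0.000005 ∧
      b < 3.73 ∧
      DAGSched.IsCapacityAugmentationFactorGlobalRM b := by
  have hcont : ContinuousOn (fun x : ℝ => x + Real.log (2 + x))
      (Set.Icc (1 / 3.621435) (1 / 3.621425)) := by
    refine continuousOn_id.add (ContinuousOn.log (by fun_prop) fun x hx => ?_)
    have h1 : (0 : ℝ) < 1 / 3.621435 := by norm_num
    linarith [hx.1]
  -- Here `x` is `1 / b`; the endpoints are the reciprocals of `3.62143 ± 0.000005`.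
  obtain ⟨x, ⟨hx1, hx2⟩, hx⟩ := intermediate_value_Ioo (by norm_num) hcont
    ⟨add_log_two_add_lt_log_three, log_three_lt_add_log_two_add⟩
  have hx0 : 0 < x := lt_trans (by norm_num) hx1
  have hlow : 3.621425 < 1 / x := by rwa [lt_one_div (by norm_num) hx0]
  have hupp : 1 / x < 3.621435 := by rwa [one_div_lt hx0 (by norm_num)]
  refine ⟨1 / x, ⟨one_div_pos.mpr hx0, ?_⟩, ?_, ?_, by linarith, ?_⟩
  · rw [one_div_one_div]
    exact (eq_log_iff hx0).mpr hx
  · intro b' hb' h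
    have hb0 := one_div_pos.mpr hb'
    have h1 := (eq_log_iff hb0).mp h
    have h2 : 1 / b' = x :=
      strictMonoOn_add_log_two_add.injOn hb0.le hx0.le (h1.trans hx.symm)
    rw [← h2, one_div_one_div]
  · rw [abs_lt]
    constructor <;> linarith
  · refine DAGSched.isCapacityAugmentationFactorGlobalRM_of_le (one_div_pos.mpr hx0) ?_
    rw [one_div_one_div]
    exact hx2.le.trans (by norm_num)
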